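/- Let $d\in\mathbb N$ and let $\mathscr S=\mathscr S(\mathbb R^d)$ be the space of real-valued Schwartz functions with its standard topology, equipped also with the norm $|||f|||:=(\|f\|_{L^1(\mathbb R^d)}^2+\|f\|_{L^2(\mathbb R^d)}^2)^{1/2}$. Let $(b,\sigma^2,\nu)$ be a characteristic triplet, i.e. $b\in\mathbb R$, $\sigma^2\ge 0$ and $\nu$ is a $\sigma$-finite Borel measure on $\mathbb R\setminus\{0\}$ with $\int\min\{1,s^2\}\,\nu(ds)<\infty$, and let $$\psi(t)=ibt-\frac{\sigma^2t^2}{2}+\int_{\mathbb R\setminus\{0\}}\bigl(e^{its}-1-its\,\mathbf 1_{\{|s|\le 1\}}(s)\bigr)\,\nu(ds),\qquad t\in\mathbb R,$$ be its Lévy characteristic. A characteristic functional on $\mathscr S$ is a continuous map $\varphi:\mathscr S\to\mathbb C$ with $\varphi(0)=1$ such that the matrix $[\varphi(f_i-f_j)]_{i,j=1}^n$ is Hermitian and positive semidefinite for all $n$ and all $f_1,\dots,f_n\in\mathscr S$. A generalized random field indexed by $\mathscr S$ is a family $(Z(f))_{f\in\mathscr S}$ of real random variables on a common probability space such that $Z(\alpha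 f+\beta g)=\alpha Z(f)+\beta Z(g)$ a.s. for all $f,g\in\mathscr S$, $\alpha,\beta\in\mathbb R$, and $Z(f)\to Z(f_0)$ in probability as $f\to f_0$ in $\mathscr S$. It is a Lévy noise field associated with $(b,\sigma^2,\nu)$ if $\psi\circ f\in L^1(\mathbb R^d)$ and $\mathbf E[e^{iZ(f)}]=\exp\bigl(\int_{\mathbb R^d}\psi(f(x))\,dx\bigr)$ for all $f\in\mathscr S$. Two fields are equivalent in law if their finite-dimensional distributions coincide. Suppose that $\int_{\{|s|>1\}}|s|\,\nu(ds)<\infty$. Then: (a) The integral defining $\psi(t)$ converges absolutely for every $t\in\mathbb R$, and $\psi\circ f\in L^1(\mathbb R^d)$ for every $f\in\mathscr S$, so that $\varphi(f):=\exp\bigl(\int_{\mathbb R^d}\psi(f(x))\,dx\bigr)$ is well defined on $\mathscr S$; moreover $\varphi$ is a characteristic functional on $\mathscr S$ and is continuous with respect to $|||\cdot|||$. (b) There exists a Lévy noise field associated with $(b,\sigma^2,\nu)$, and any two such fields (possibly on different probability spaces) are equivalent in law. (c) Every Lévy noise field $Z$ associated with $(b,\sigma^2,\nu)$ is continuous with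 respect to $|||\cdot|||$: $|||f-f_0|||\to 0$ implies $Z(f)\to Z(f_0)$ in probability. -/

import Mathlib

open MeasureTheory Filter Topology
open scoped ComplexOrder SchwartzMap ENNReal

/-- The space of real-valued Schwartz functions on `ℝ^d`, with its standard topology. -/
abbrev TestSpace (d : ℕ) : Type := 𝓢(EuclideanSpace ℝ (Fin d), ℝ)

/-! ### Characteristic functionals and generalized random fields

These notions are used for real locally convex spaces `V`. -/

/-- Characteristic functionals on `V`: normalized, continuous and positive definite, i.e. all the
matrices `[φ (f i - f j)]` are Hermitian and positive semidefinite. -/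
structure IsCharacteristicFunctional {V : Type*} [AddCommGroup V] [TopologicalSpace V]
    (φ : V → ℂ) : Prop where
  map_zero : φ 0 = 1
  continuous : Continuous φ
  posDef : ∀ (n : ℕ) (f : Fin n → V), (Matrix.of fun i j => φ (f i - f j)).PosSemidef

/-- Generalized random fields indexed by `V`: real random variables `Z f` on a common probability
space, almost surely linear in `f`, and continuous in probability. -/
structure IsGeneralizedRandomField {V : Type*} [AddCommGroup V] [Module ℝ V] [TopologicalSpace V]
    {Ω : Type*} [MeasurableSpace Ω] (P : Measure Ω) (Z : V → Ω → ℝ) : Prop where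
  isProbabilityMeasure : IsProbabilityMeasure P
  measurable : ∀ f, Measurable (Z f)
  linear : ∀ (α β : ℝ) (f g : V), ∀ᵐ ω ∂P, Z (α • f + β • g) ω = α * Z f ω + β * Z g ω
  stochCont : ∀ f₀ : V, TendstoInMeasure P Z (𝓝 f₀) (Z f₀)

/-- Equivalence in law: the finite-dimensional distributions coincide. -/
def EquivalentInLaw {V : Type*} {Ω Ω' : Type*} [MeasurableSpace Ω] [MeasurableSpace Ω']
    (P : Measure Ω) (Z : V → Ω → ℝ) (P' : Measure Ω') (Z' : V → Ω' → ℝ) : Prop :=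
  ∀ (n : ℕ) (f : Fin n → V) (A : Fin n → Set ℝ), (∀ i, MeasurableSet (A i)) →
    P {ω | ∀ i, Z (f i) ω ∈ A i} = P' {ω | ∀ i, Z' (f i) ω ∈ A i}

/-- The Fourier transform `f ↦ E[exp (i Z(f))]` of a random field. -/
noncomputable def fieldFourierTransform {V : Type*} {Ω : Type*} [MeasurableSpace Ω]
    (P : Measure Ω) (Z : V → Ω → ℝ) (f : V) : ℂ :=
  ∫ ω, Complex.exp (Complex.I * (Z f ω : ℂ)) ∂P

/-! ### The norm `(‖f‖₁² + ‖f‖₂²)^(1/2)` -/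

/-- The norm `(‖f‖_{L¹}² + ‖f‖_{L²}²)^(1/2)` of a Schwartz function. -/
noncomputable def tripleNorm {d : ℕ} (f : TestSpace d) : ℝ :=
  Real.sqrt ((eLpNorm f 1 volume).toReal ^ 2 + (eLpNorm f 2 volume).toReal ^ 2)

/-- The neighbourhoods of `f₀` in the topology given by `tripleNorm`. -/
noncomputable def tripleNhds {d : ℕ} (f₀ : TestSpace d) : Filter (TestSpace d) :=
  comap (fun f => tripleNorm (f - f₀)) (𝓝 0)

/-- Continuity of a functional on Schwartz space with respect to `tripleNorm`. -/
def TripleContinuous {d : ℕ} (φ : TestSpace d → ℂ) : Prop :=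
  ∀ f₀, Tendsto φ (tripleNhds f₀) (𝓝 (φ f₀))

/-- Continuity of a random field with respect to `tripleNorm` on the index space and convergence
in probability. -/
def TripleStochContinuous {d : ℕ} {Ω : Type*} [MeasurableSpace Ω] (P : Measure Ω)
    (Z : TestSpace d → Ω → ℝ) : Prop :=
  ∀ f₀, TendstoInMeasure P Z (tripleNhds f₀) (Z f₀)

/-! ### Lévy characteristics and Lévy noise fields -/

/-- Characteristic triplets `(b, σ², ν)`. A measure on `ℝ \ {0}` is given as a measure on `ℝ`
without mass at `0`. -/
structure CharacteristicTriplet where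
  b : ℝ
  sigmaSq : ℝ
  sigmaSq_nonneg : 0 ≤ sigmaSq
  ν : Measure ℝ
  sigmaFinite : SigmaFinite ν
  ν_zero : ν {0} = 0
  lintegral_lt_top : ∫⁻ s, ENNReal.ofReal (min 1 (s ^ 2)) ∂ν < ∞

namespace CharacteristicTriplet

/-- The integrand `e^{its} - 1 - its 1_{|s| ≤ 1}` of the Lévy characteristic. -/
noncomputable def jumpIntegrand (t s : ℝ) : ℂ :=
  Complex.exp (Complex.I * t * s) - 1
    - Set.indicator {s : ℝ | |s| ≤ 1} (fun s : ℝ => Complex.I * t * s) s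

/-- The Lévy characteristic `ψ` of a triplet. -/
noncomputable def psi (T : CharacteristicTriplet) (t : ℝ) : ℂ :=
  Complex.I * T.b * t - T.sigmaSq * t ^ 2 / 2 + ∫ s, jumpIntegrand t s ∂T.ν

/-- The functional `f ↦ exp (∫ ψ(f(x)) dx)` on Schwartz space. -/
noncomputable def levyFunctional (T : CharacteristicTriplet) {d : ℕ} (f : TestSpace d) : ℂ :=
  Complex.exp (∫ x, T.psi (f x))

end CharacteristicTriplet

/-- `Z` is a Lévy noise field associated with the characteristic triplet `T`. -/
structure IsLevyNoiseField (T : CharacteristicTriplet) {d : ℕ} {Ω : Type*} [MeasurableSpace Ω]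
    (P : Measure Ω) (Z : TestSpace d → Ω → ℝ) : Prop where
  isGeneralizedRandomField : IsGeneralizedRandomField P Z
  integrable : ∀ f : TestSpace d, Integrable (fun x => T.psi (f x))
  fourier_eq : ∀ f, fieldFourierTransform P Z f = T.levyFunctional f

/-! ### Bounds for the jump integrand -/

/-! Everything analytic rests on one modulus of continuity, |ψ(t) - ψ(u)| ≤ C((t - u)² + (1 + |u|)|t
- u|), which is `norm_psi_sub_le`. The first moment of ν on {|s| > 1} makes the large jumps
Lipschitz in t. Integrated along f and a bounded f₀, the quadratic term becomes ‖f - f₀‖₂² and the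
linear one a multiple of ‖f - f₀‖₁, which is why the mixed norm is the right one. The case u = 0
gives ψ ∘ f ∈ L¹.

Positive definiteness and existence have a common source: for fixed f₁, …, fₙ, the function z ↦ φ(∑
zᵢ fᵢ) is the characteristic function of a probability measure on ℝⁿ (`isCharFun_exp_integral_psi`).
With F = (f₁, …, fₙ), exp ∫ ψ(⟨F, z⟩) is a product of a drift factor, a Gaussian factor with
covariance σ² ∫ Fᵢ Fⱼ, and a jump factor for dx ⊗ ν. The jump factor is a limit of shifted compound
Poisson transforms over finite pieces of dx ⊗ ν, and Lévy's continuity theorem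
(`IsCharFun.of_tendsto`) covers the limit.

Evaluating these laws at basis vectors gives the positive semidefinite matrices. The laws are
consistent, so Kolmogorov's theorem puts a measure on ℝ^𝓢. Its coordinate process is almost surely
linear, because φ sees a formal linear combination only through its value in 𝓢. Conversely,
linearity expresses all finite-dimensional Fourier transforms of a field through φ, whence
uniqueness. Continuity in probability follows by bounding the tail of Z(f - f₀) by its
characteristic function near 0 (`tripleStochContinuous_of_fourier`). -/

lemma norm_exp_I_mul_sub_one_sub_id_le (x : ℝ) :
    ‖Complex.exp (Complex.I * x) - 1 - Complex.I * x‖ ≤ 2 * x ^ 2 := by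
  have hn : ‖Complex.I * (x : ℂ)‖ = |x| := by simp
  rcases le_total |x| 1 with h | h
  · have := Complex.norm_exp_sub_one_sub_id_le (x := Complex.I * (x : ℂ)) (by rw [hn]; exact h)
    rw [hn, sq_abs] at this
    nlinarith [sq_nonneg x]
  · have h1 := Real.norm_exp_I_mul_ofReal_sub_one_le (x := x)
    have h2 := norm_sub_le (Complex.exp (Complex.I * x) - 1) (Complex.I * x)
    rw [hn] at h2
    rw [Real.norm_eq_abs] at h1
    nlinarith [sq_abs x]

namespace CharacteristicTriplet

/-- The function `s ↦ s² 1_{|s| ≤ 1} + |s| 1_{|s| > 1}`, which controls the jump integrand. -/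
noncomputable def jumpWeight (s : ℝ) : ℝ := if |s| ≤ 1 then s ^ 2 else |s|

lemma measurable_jumpWeight : Measurable jumpWeight :=
  Measurable.ite (measurableSet_le (by fun_prop) measurable_const) (by fun_prop) (by fun_prop)

lemma jumpWeight_nonneg (s : ℝ) : 0 ≤ jumpWeight s := by
  unfold jumpWeight; split_ifs <;> positivity

lemma measurable_jumpIntegrand :
    Measurable (fun p : ℝ × ℝ => jumpIntegrand p.1 p.2) := by
  unfold jumpIntegrand
  refine Measurable.sub (by fun_prop) ?_
  have : (fun p : ℝ × ℝ => Set.indicator {s : ℝ | |s| ≤ 1}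
      (fun s : ℝ => Complex.I * p.1 * s) p.2) =
      Set.indicator {p : ℝ × ℝ | |p.2| ≤ 1} (fun p => Complex.I * p.1 * p.2) := by
    ext p; simp [Set.indicator]
  rw [this]
  exact Measurable.indicator (by fun_prop) (measurableSet_le (by fun_prop) measurable_const)

@[simp] lemma jumpIntegrand_zero_left (s : ℝ) : jumpIntegrand 0 s = 0 := by
  simp [jumpIntegrand]

@[simp] lemma jumpIntegrand_zero_right (t : ℝ) : jumpIntegrand t 0 = 0 := by
  simp [jumpIntegrand]

/-- Factor out exp(ius), which has modulus one. For large jumps only |exp(i(t - u)s) - 1| ≤ |t -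
u||s| remains. For small jumps the compensator leaves a second-order remainder in (t - u)s plus the
cross term (exp(ius) - 1) · i(t - u)s, the source of the factor |u|. -/
lemma norm_jumpIntegrand_sub_le (t u s : ℝ) :
    ‖jumpIntegrand t s - jumpIntegrand u s‖ ≤
      2 * ((t - u) ^ 2 + (1 + |u|) * |t - u|) * jumpWeight s := by
  have hexp : Complex.exp (Complex.I * t * s) = Complex.exp (Complex.I * (u * s : ℝ)) *
      Complex.exp (Complex.I * ((t - u) * s : ℝ)) := by
    rw [← Complex.exp_add]; push_cast; ring_nf
  have hexp' : Complex.exp (Complex.I * u * s) = Complex.exp (Complex.I * (u * s : ℝ)) := by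
    push_cast; ring_nf
  have hu := abs_nonneg u
  have ht := abs_nonneg (t - u)
  have h1 := Complex.norm_exp_I_mul_ofReal (u * s)
  by_cases hs : |s| ≤ 1
  · have hw : jumpWeight s = s ^ 2 := if_pos hs
    have hid : jumpIntegrand t s - jumpIntegrand u s =
        Complex.exp (Complex.I * (u * s : ℝ)) * (Complex.exp (Complex.I * ((t - u) * s : ℝ)) - 1
          - Complex.I * ((t - u) * s : ℝ)) +
        (Complex.exp (Complex.I * (u * s : ℝ)) - 1) * (Complex.I * ((t - u) * s : ℝ)) := by
      rw [jumpIntegrand, jumpIntegrand, hexp, hexp', Set.indicator_of_mem (by exact hs),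
        Set.indicator_of_mem (by exact hs)]
      push_cast; ring
    rw [hid, hw]
    refine (norm_add_le _ _).trans ?_
    rw [norm_mul, norm_mul, h1, one_mul]
    have h2 := norm_exp_I_mul_sub_one_sub_id_le ((t - u) * s)
    have h3 := Real.norm_exp_I_mul_ofReal_sub_one_le (x := u * s)
    have h4 : ‖Complex.I * (((t - u) * s : ℝ) : ℂ)‖ = |t - u| * |s| := by
      rw [norm_mul, Complex.norm_I, one_mul, Complex.norm_real, Real.norm_eq_abs, abs_mul]
    rw [h4]
    rw [Real.norm_eq_abs, abs_mul] at h3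
    have h5 : ‖Complex.exp (Complex.I * (u * s : ℝ)) - 1‖ * (|t - u| * |s|) ≤
        |u| * |s| * (|t - u| * |s|) := by gcongr
    have h6 : |u| * |s| * (|t - u| * |s|) = |u| * |t - u| * s ^ 2 := by
      rw [← sq_abs s]; ring
    have h7 : 0 ≤ |u| * |t - u| * s ^ 2 := by positivity
    have h8 : 0 ≤ |t - u| * s ^ 2 := by positivity
    nlinarith
  · have hw : jumpWeight s = |s| := if_neg hs
    have hid : jumpIntegrand t s - jumpIntegrand u s = Complex.exp (Complex.I * (u * s : ℝ)) *
        (Complex.exp (Complex.I * ((t - u) * s : ℝ)) - 1) := by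
      rw [jumpIntegrand, jumpIntegrand, hexp, hexp', Set.indicator_of_notMem (by exact hs),
        Set.indicator_of_notMem (by exact hs)]
      ring
    rw [hid, hw, norm_mul, h1, one_mul]
    have h3 := Real.norm_exp_I_mul_ofReal_sub_one_le (x := (t - u) * s)
    rw [Real.norm_eq_abs, abs_mul] at h3
    refine h3.trans ?_
    have h9 : 0 ≤ |u| * |t - u| := by positivity
    gcongr
    nlinarith [sq_nonneg (t - u)]

lemma norm_jumpIntegrand_le (t s : ℝ) :
    ‖jumpIntegrand t s‖ ≤ 2 * (t ^ 2 + |t|) * jumpWeight s := by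
  simpa using norm_jumpIntegrand_sub_le t 0 s

/-! ### Integrability and modulus of continuity of the Lévy characteristic. -/

variable (T : CharacteristicTriplet)

/-- The moment hypothesis covers |s| > 1, and the triplet condition covers |s| ≤ 1, where min{1, s²}
= s². All later uses of the moment hypothesis pass through this lemma. -/
lemma integrable_jumpWeight (hT : ∫⁻ s in {s : ℝ | 1 < |s|}, ENNReal.ofReal |s| ∂T.ν < ∞) :
    Integrable jumpWeight T.ν := by
  refine ⟨measurable_jumpWeight.aestronglyMeasurable, ?_⟩
  rw [hasFiniteIntegral_iff_ofReal (Eventually.of_forall jumpWeight_nonneg)]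
  have hm : MeasurableSet {s : ℝ | 1 < |s|} := measurableSet_lt measurable_const (by fun_prop)
  rw [← lintegral_add_compl _ hm]
  refine ENNReal.add_lt_top.2 ⟨?_, ?_⟩
  · refine lt_of_le_of_lt (setLIntegral_mono (by fun_prop) fun s hs => ?_) hT
    rw [jumpWeight, if_neg (not_le.2 hs)]
  · refine lt_of_le_of_lt ((setLIntegral_mono (by fun_prop) fun s hs => ?_).trans
      (setLIntegral_le_lintegral _ _)) T.lintegral_lt_top
    have hs' : |s| ≤ 1 := not_lt.1 hs
    rw [jumpWeight, if_pos hs', min_eq_right]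
    rw [← sq_abs]; exact pow_le_one₀ (abs_nonneg s) hs'

lemma integrable_jumpIntegrand
    (hT : ∫⁻ s in {s : ℝ | 1 < |s|}, ENNReal.ofReal |s| ∂T.ν < ∞) (t : ℝ) :
    Integrable (jumpIntegrand t) T.ν :=
  ((T.integrable_jumpWeight hT).const_mul (2 * (t ^ 2 + |t|))).mono'
    (measurable_jumpIntegrand.comp measurable_prodMk_left).aestronglyMeasurable
    (Eventually.of_forall fun s => norm_jumpIntegrand_le t s)

@[simp] lemma psi_zero : T.psi 0 = 0 := by simp [psi]

/-- The constant in the modulus of continuity of the Lévy characteristic. -/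
noncomputable def psiBound : ℝ := |T.b| + T.sigmaSq + 2 * ∫ s, jumpWeight s ∂T.ν

lemma psiBound_nonneg : 0 ≤ T.psiBound := by
  have := T.sigmaSq_nonneg
  have : 0 ≤ ∫ s, jumpWeight s ∂T.ν := integral_nonneg jumpWeight_nonneg
  unfold psiBound; positivity

lemma norm_psi_sub_le (hT : ∫⁻ s in {s : ℝ | 1 < |s|}, ENNReal.ofReal |s| ∂T.ν < ∞) (t u : ℝ) :
    ‖T.psi t - T.psi u‖ ≤ T.psiBound * ((t - u) ^ 2 + (1 + |u|) * |t - u|) := by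
  have hid : T.psi t - T.psi u = Complex.I * ((T.b * (t - u) : ℝ) : ℂ) +
      -((T.sigmaSq * ((t ^ 2 - u ^ 2) / 2) : ℝ) : ℂ) +
      ∫ s, (jumpIntegrand t s - jumpIntegrand u s) ∂T.ν := by
    rw [integral_sub (T.integrable_jumpIntegrand hT t) (T.integrable_jumpIntegrand hT u)]
    unfold psi; push_cast; ring
  have hσ := T.sigmaSq_nonneg
  have h1 : ‖Complex.I * ((T.b * (t - u) : ℝ) : ℂ)‖ = |T.b| * |t - u| := by
    rw [norm_mul, Complex.norm_I, one_mul, Complex.norm_real, Real.norm_eq_abs, abs_mul]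
  have h2 : ‖-((T.sigmaSq * ((t ^ 2 - u ^ 2) / 2) : ℝ) : ℂ)‖ ≤
      T.sigmaSq * ((t - u) ^ 2 + |u| * |t - u|) := by
    rw [norm_neg, Complex.norm_real, Real.norm_eq_abs, abs_mul, abs_of_nonneg hσ]
    gcongr
    -- Expanding around u keeps the bound free of |t|, so that later only f₀, and not f, has to be
    -- bounded.
    rw [show (t ^ 2 - u ^ 2) / 2 = (t - u) ^ 2 / 2 + u * (t - u) by ring]
    refine (abs_add_le _ _).trans ?_
    rw [abs_mul, abs_of_nonneg (by positivity : (0:ℝ) ≤ (t - u) ^ 2 / 2)]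
    nlinarith [sq_nonneg (t - u)]
  have h3 : ‖∫ s, (jumpIntegrand t s - jumpIntegrand u s) ∂T.ν‖ ≤
      2 * ((t - u) ^ 2 + (1 + |u|) * |t - u|) * ∫ s, jumpWeight s ∂T.ν := by
    rw [← integral_const_mul]
    exact norm_integral_le_of_norm_le ((T.integrable_jumpWeight hT).const_mul _)
      (Eventually.of_forall fun s => norm_jumpIntegrand_sub_le t u s)
  rw [hid]
  refine ((norm_add_le _ _).trans (add_le_add_left (norm_add_le _ _) _)).trans ?_
  rw [h1]
  have h4 : 0 ≤ |T.b| * (t - u) ^ 2 := by positivity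
  have h5 : 0 ≤ |T.b| * (|u| * |t - u|) := by positivity
  have h6 : 0 ≤ T.sigmaSq * |t - u| := by positivity
  unfold psiBound
  nlinarith

lemma norm_psi_le (hT : ∫⁻ s in {s : ℝ | 1 < |s|}, ENNReal.ofReal |s| ∂T.ν < ∞) (t : ℝ) :
    ‖T.psi t‖ ≤ T.psiBound * (t ^ 2 + |t|) := by
  simpa using T.norm_psi_sub_le hT t 0

lemma measurable_psi : Measurable T.psi := by
  have := T.sigmaFinite
  unfold psi
  refine Measurable.add (by fun_prop) ?_
  exact (StronglyMeasurable.integral_prod_right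
    (f := fun t s => jumpIntegrand t s) measurable_jumpIntegrand.stronglyMeasurable).measurable

lemma integrable_psi_comp (hT : ∫⁻ s in {s : ℝ | 1 < |s|}, ENNReal.ofReal |s| ∂T.ν < ∞)
    {X : Type*} [MeasurableSpace X] {μ : Measure X} {f : X → ℝ}
    (h1 : Integrable f μ) (h2 : MemLp f 2 μ) : Integrable (fun x => T.psi (f x)) μ :=
  ((h2.integrable_sq.add h1.norm).const_mul T.psiBound).mono'
    (T.measurable_psi.comp_aemeasurable h1.aemeasurable).aestronglyMeasurable
    (Eventually.of_forall fun x => T.norm_psi_le hT (f x))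

lemma integrable_psi_schwartz (hT : ∫⁻ s in {s : ℝ | 1 < |s|}, ENNReal.ofReal |s| ∂T.ν < ∞)
    {d : ℕ} (f : TestSpace d) : Integrable (fun x => T.psi (f x)) :=
  T.integrable_psi_comp hT f.integrable (f.memLp 2)

end CharacteristicTriplet

/-! ### The mixed norm -/

section MixedNorm

variable {d : ℕ}

lemma tripleNorm_nonneg (f : TestSpace d) : 0 ≤ tripleNorm f := Real.sqrt_nonneg _

lemma integral_abs_le_tripleNorm (f : TestSpace d) : ∫ x, |f x| ≤ tripleNorm f := by
  have h : ∫ x, |f x| = (eLpNorm f 1 volume).toReal := by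
    rw [eLpNorm_one_eq_lintegral_enorm, ← integral_norm_eq_lintegral_enorm
      f.integrable.aestronglyMeasurable]
    rfl
  rw [h, tripleNorm]
  exact Real.le_sqrt_of_sq_le (le_add_of_nonneg_right (sq_nonneg _))

lemma integral_sq_le_tripleNorm_sq (f : TestSpace d) : ∫ x, f x ^ 2 ≤ tripleNorm f ^ 2 := by
  have h : ∫ x, f x ^ 2 = (eLpNorm f 2 volume).toReal ^ 2 := by
    have := (f.memLp 2 volume).eLpNorm_eq_integral_rpow_norm two_ne_zero ENNReal.ofNat_ne_top
    have hn : 0 ≤ ∫ x, f x ^ 2 := integral_nonneg fun x => sq_nonneg _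
    rw [this, ENNReal.toReal_ofReal (by positivity)]
    simp only [ENNReal.toReal_ofNat, Real.rpow_ofNat, Real.norm_eq_abs, sq_abs]
    rw [← Real.rpow_natCast, ← Real.rpow_mul hn]
    norm_num
  rw [h, tripleNorm, Real.sq_sqrt (by positivity)]
  exact le_add_of_nonneg_left (sq_nonneg _)

lemma tripleNorm_smul (c : ℝ) (f : TestSpace d) : tripleNorm (c • f) = |c| * tripleNorm f := by
  unfold tripleNorm
  rw [← Real.sqrt_sq_eq_abs, ← Real.sqrt_mul (sq_nonneg c)]
  have h (p : ℝ≥0∞) : (eLpNorm (c • f : TestSpace d) p volume).toReal =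
      |c| * (eLpNorm f p volume).toReal := by
    have : ((c • f : TestSpace d) : EuclideanSpace ℝ (Fin d) → ℝ) = c • ⇑f := rfl
    rw [this, eLpNorm_const_smul, ENNReal.toReal_mul]
    simp
  rw [h, h, mul_pow, mul_pow, sq_abs]
  ring_nf

lemma continuous_tripleNorm : Continuous (tripleNorm : TestSpace d → ℝ) := by
  have h (p : ℝ≥0∞) [Fact (1 ≤ p)] :
      Continuous fun f : TestSpace d => (eLpNorm f p volume).toReal := by
    have := (SchwartzMap.continuous_toLp (F := ℝ) (E := EuclideanSpace ℝ (Fin d)) (p := p)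
      (μ := volume)).norm
    simpa only [SchwartzMap.norm_toLp] using this
  have : Fact ((1 : ℝ≥0∞) ≤ 2) := ⟨one_le_two⟩
  unfold tripleNorm
  exact Real.continuous_sqrt.comp (((h 1).pow 2).add ((h 2).pow 2))

/-- The Schwartz topology is finer, since 𝓢 embeds continuously in L¹ and L². Hence continuity in
the mixed norm, for the functional and for the field, yields continuity in the standard topology. -/
lemma nhds_le_tripleNhds (f₀ : TestSpace d) : 𝓝 f₀ ≤ tripleNhds f₀ := by
  refine tendsto_iff_comap.1 ?_
  have h : Continuous fun f : TestSpace d => tripleNorm (f - f₀) :=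
    continuous_tripleNorm.comp (continuous_id.sub continuous_const)
  have h0 : tripleNorm (f₀ - f₀) = 0 := by
    have := tripleNorm_smul 0 f₀
    simpa using this
  simpa only [h0] using h.tendsto f₀

lemma tendsto_tripleNorm_sub (f₀ : TestSpace d) :
    Tendsto (fun f => tripleNorm (f - f₀)) (tripleNhds f₀) (𝓝 0) :=
  tendsto_comap

lemma TripleContinuous.continuous {φ : TestSpace d → ℂ} (h : TripleContinuous φ) :
    Continuous φ :=
  continuous_iff_continuousAt.2 fun f₀ => (h f₀).mono_left (nhds_le_tripleNhds f₀)

lemma TripleStochContinuous.tendstoInMeasure {Ω : Type*} [MeasurableSpace Ω] {P : Measure Ω}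
    {Z : TestSpace d → Ω → ℝ} (h : TripleStochContinuous P Z) (f₀ : TestSpace d) :
    TendstoInMeasure P Z (𝓝 f₀) (Z f₀) :=
  fun ε hε => (h f₀ ε hε).mono_left (nhds_le_tripleNhds f₀)

/-! ### Continuity of the Lévy functional in the mixed norm. -/

namespace CharacteristicTriplet

variable (T : CharacteristicTriplet)

lemma norm_integral_psi_sub_le
    (hT : ∫⁻ s in {s : ℝ | 1 < |s|}, ENNReal.ofReal |s| ∂T.ν < ∞) (f f₀ : TestSpace d) {M : ℝ}
    (hM : ∀ x, |f₀ x| ≤ M) :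
    ‖(∫ x, T.psi (f x)) - ∫ x, T.psi (f₀ x)‖ ≤
      T.psiBound * (tripleNorm (f - f₀) ^ 2 + (1 + M) * tripleNorm (f - f₀)) := by
  have hM0 : 0 ≤ M := (abs_nonneg _).trans (hM 0)
  have hi1 : Integrable fun x => (f - f₀) x ^ 2 := ((f - f₀).memLp 2).integrable_sq
  have hi2 : Integrable fun x => (1 + M) * |(f - f₀) x| := (f - f₀).integrable.norm.const_mul _
  rw [← integral_sub (T.integrable_psi_schwartz hT f) (T.integrable_psi_schwartz hT f₀)]
  refine (norm_integral_le_of_norm_le (g := fun x => T.psiBound *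
    ((f - f₀) x ^ 2 + (1 + M) * |(f - f₀) x|)) ((hi1.add hi2).const_mul _)
    (Eventually.of_forall fun x => ?_)).trans ?_
  · refine (T.norm_psi_sub_le hT _ _).trans ?_
    have := hM x
    rw [sub_apply]
    gcongr
    exact T.psiBound_nonneg
  · rw [integral_const_mul, integral_add hi1 hi2, integral_const_mul]
    have h1 := integral_abs_le_tripleNorm (f - f₀)
    have h2 := integral_sq_le_tripleNorm_sq (f - f₀)
    gcongr
    exact T.psiBound_nonneg

lemma norm_integral_psi_le
    (hT : ∫⁻ s in {s : ℝ | 1 < |s|}, ENNReal.ofReal |s| ∂T.ν < ∞) (f : TestSpace d) :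
    ‖∫ x, T.psi (f x)‖ ≤ T.psiBound * (tripleNorm f ^ 2 + tripleNorm f) := by
  have := T.norm_integral_psi_sub_le hT f 0 (M := 0) (by simp)
  simpa using this

theorem tripleContinuous_levyFunctional
    (hT : ∫⁻ s in {s : ℝ | 1 < |s|}, ENNReal.ofReal |s| ∂T.ν < ∞) :
    TripleContinuous (fun f : TestSpace d => T.levyFunctional f) := by
  intro f₀
  refine (Complex.continuous_exp.tendsto _).comp ?_
  rw [tendsto_iff_norm_sub_tendsto_zero]
  have hM (x) : |f₀ x| ≤ SchwartzMap.seminorm ℝ 0 0 f₀ := SchwartzMap.norm_le_seminorm ℝ f₀ x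
  refine squeeze_zero (fun f => norm_nonneg _)
    (fun f => T.norm_integral_psi_sub_le hT f f₀ hM) ?_
  have h := tendsto_tripleNorm_sub f₀
  simpa using ((h.pow 2).add (h.const_mul (1 + SchwartzMap.seminorm ℝ 0 0 f₀))).const_mul
    T.psiBound

@[simp] lemma levyFunctional_zero : T.levyFunctional (0 : TestSpace d) = 1 := by
  simp [levyFunctional]

end CharacteristicTriplet

end MixedNorm

/-! ### Kolmogorov's extension theorem for real-valued families -/

section Kolmogorov

variable {ι : Type*}

/-- If the coordinates of a sequence in `ι → ℝ` eventually satisfy a sequence of compact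
finite-dimensional constraints, then these constraints are jointly satisfiable. -/
lemma nonempty_iInter_cylinder_of_isCompact {s : ℕ → Finset ι} {K : ∀ n, Set (s n → ℝ)}
    (hK : ∀ n, IsCompact (K n))
    (hne : ∀ n, ∃ x : ι → ℝ, ∀ k ≤ n, x ∈ cylinder (α := fun _ : ι => ℝ) (s k) (K k)) :
    (⋂ n, cylinder (α := fun _ : ι => ℝ) (s n) (K n)).Nonempty := by
  classical
  choose x hx using hne
  -- Coordinates that no constraint involves are set to 0, so that every coordinate of the sequence
  -- stays in a compact set.
  let y : ℕ → ι → ℝ := fun n i => if ∃ k, i ∈ s k then x n i else 0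
  have hy (n k : ℕ) (hk : k ≤ n) : y n ∈ cylinder (α := fun _ : ι => ℝ) (s k) (K k) := by
    have : (s k).restrict (y n) = (s k).restrict (x n) := by
      ext i
      exact if_pos ⟨k, i.2⟩
    rw [mem_cylinder, this]
    exact hx n k hk
  have hC (i : ι) : ∃ C : Set ℝ, IsCompact C ∧ ∀ n, y n i ∈ C := by
    by_cases hi : ∃ k, i ∈ s k
    · obtain ⟨k, hk⟩ := hi
      -- From index k on, the constraint K k confines coordinate i; the finitely many earlier values
      -- are added by hand.
      refine ⟨(fun z : s k → ℝ => z ⟨i, hk⟩) '' K k ∪ (fun n => y n i) '' Set.Iio k,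
        ((hK k).image (continuous_apply _)).union ((Set.finite_Iio k).image _).isCompact,
        fun n => ?_⟩
      rcases lt_or_ge n k with h | h
      · exact Or.inr ⟨n, h, rfl⟩
      · exact Or.inl ⟨_, hy n k h, rfl⟩
    · exact ⟨{0}, isCompact_singleton, fun n => if_neg hi⟩
  choose C hCc hCy using hC
  -- Tychonoff gives a cluster point; each cylinder is closed and eventually contains the sequence,
  -- so it contains this point.
  obtain ⟨z, -, hz⟩ := (isCompact_univ_pi hCc).exists_mapClusterPt (f := atTop) (u := y)
    (tendsto_principal.2 (Eventually.of_forall fun n i _ => hCy i n))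
  refine ⟨z, Set.mem_iInter.2 fun k => ?_⟩
  have hcl : IsClosed (cylinder (α := fun _ : ι => ℝ) (s k) (K k)) := IsClosed.cylinder (α := fun _ : ι => ℝ) (s k) (hK k).isClosed
  refine hcl.closure_subset ?_
  rw [mem_closure_iff_clusterPt]
  exact ClusterPt.mono hz (tendsto_principal.2
    ((eventually_ge_atTop k).mono fun n hn => hy n k hn))

variable {P : ∀ J : Finset ι, Measure (J → ℝ)}

/-- If the contents stayed above ε > 0, inner regularity would replace the bases of the A n by
compact sets at a total loss below ε. Any finite number of the compact cylinders would then still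
meet, and compactness would give a point of ⋂ A n. This continuity at ∅ is what upgrades the content
to a measure. -/
lemma projectiveFamilyContent_tendsto_zero [∀ J, IsProbabilityMeasure (P J)]
    (hP : IsProjectiveMeasureFamily (α := fun _ : ι => ℝ) P) {A : ℕ → Set (ι → ℝ)}
    (A_mem : ∀ n, A n ∈ measurableCylinders fun _ : ι => ℝ) (A_anti : Antitone A)
    (A_inter : ⋂ n, A n = ∅) :
    Tendsto (fun n => projectiveFamilyContent hP (A n)) atTop (𝓝 0) := by
  have hmono : Antitone fun n => projectiveFamilyContent hP (A n) := fun m n hmn =>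
    projectiveFamilyContent_mono hP (A_mem n) (A_mem m) (A_anti hmn)
  by_contra hlim
  obtain ⟨ε, hε, hεA⟩ : ∃ ε : ℝ≥0∞, 0 < ε ∧ ∀ n, ε ≤ projectiveFamilyContent hP (A n) := by
    refine ⟨⨅ n, projectiveFamilyContent hP (A n), ?_, fun n => iInf_le _ n⟩
    refine pos_iff_ne_zero.2 fun h0 => hlim ?_
    rw [← h0]
    exact tendsto_atTop_iInf hmono
  choose s S hS hA using fun n => (mem_measurableCylinders _).1 (A_mem n)
  obtain ⟨δ, hδ, hδε⟩ := ENNReal.exists_pos_sum_of_countable hε.ne' ℕ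
  have hreg (n : ℕ) : ∃ K ⊆ S n, IsCompact K ∧ P (s n) (S n \ K) < δ n :=
    (hS n).exists_isCompact_sdiff_lt (measure_ne_top _ _) (by exact_mod_cast (hδ n).ne')
  choose K hKS hK hKδ using hreg
  have hKm (n : ℕ) : MeasurableSet (K n) := (hK n).isClosed.measurableSet
  obtain ⟨z, hz⟩ := nonempty_iInter_cylinder_of_isCompact hK fun n => by
    by_contra! hcon
    -- If the first n + 1 compact cylinders had no common point, A n would be covered by the
    -- discarded parts, whose total content is below ε.
    have hsub : A n ⊆ ⋃ i ≤ n, cylinder (α := fun _ : ι => ℝ) (s i) (S i \ K i) := by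
      intro x hx
      obtain ⟨k, hk, hxk⟩ := hcon x
      refine Set.mem_iUnion₂.2 ⟨k, hk, ?_, hxk⟩
      have := A_anti hk hx
      rwa [hA k] at this
    have hmem (i : ℕ) :
        cylinder (α := fun _ : ι => ℝ) (s i) (S i \ K i) ∈ measurableCylinders fun _ : ι => ℝ :=
      cylinder_mem_measurableCylinders _ _ ((hS i).diff (hKm i))
    have hU : (⋃ i ≤ n, cylinder (α := fun _ : ι => ℝ) (s i) (S i \ K i)) ∈ measurableCylinders fun _ : ι => ℝ := by
      have := isSetRing_measurableCylinders (α := fun _ : ι => ℝ) |>.biUnion_mem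
        (Finset.range (n + 1)) (fun i _ => hmem i)
      simpa only [Finset.mem_range_succ_iff] using this
    refine absurd ((hεA n).trans (projectiveFamilyContent_mono hP (A_mem n) hU hsub)) ?_
    refine not_le.2 (lt_of_le_of_lt (projectiveFamilyContent_iUnion_le hP hmem n) ?_)
    refine lt_of_le_of_lt (Finset.sum_le_sum (g := fun i => (δ i : ℝ≥0∞)) fun i _ => ?_)
      (lt_of_le_of_lt (ENNReal.sum_le_tsum _) hδε)
    rw [projectiveFamilyContent_cylinder hP ((hS i).diff (hKm i))]
    exact (hKδ i).le
  have : z ∈ ⋂ n, A n := Set.mem_iInter.2 fun n => by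
    rw [hA n]
    exact hKS n (Set.mem_iInter.1 hz n)
  rw [A_inter] at this
  exact this

/-- **Kolmogorov's extension theorem** for real-valued processes. -/
theorem exists_isProjectiveLimit [∀ J, IsProbabilityMeasure (P J)]
    (hP : IsProjectiveMeasureFamily (α := fun _ : ι => ℝ) P) :
    ∃ μ : Measure (ι → ℝ), IsProjectiveLimit (α := fun _ : ι => ℝ) μ P := by
  have hsub : (projectiveFamilyContent hP).IsSigmaSubadditive :=
    isSigmaSubadditive_of_addContent_iUnion_eq_tsum isSetRing_measurableCylinders
      fun f hf hf_Union hf' =>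
        addContent_iUnion_eq_sum_of_tendsto_zero isSetRing_measurableCylinders
          (projectiveFamilyContent hP) (fun _ _ => projectiveFamilyContent_ne_top _)
          (fun _ => projectiveFamilyContent_tendsto_zero hP) hf hf_Union hf'
  refine ⟨(projectiveFamilyContent hP).measure isSetSemiring_measurableCylinders
    generateFrom_measurableCylinders.ge hsub, fun I => ?_⟩
  ext s hs
  rw [Measure.map_apply (Finset.measurable_restrict I) hs, AddContent.measure_eq,
    ← cylinder, projectiveFamilyContent_cylinder hP hs]
  · exact generateFrom_measurableCylinders.symm
  · exact cylinder_mem_measurableCylinders _ _ hs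

end Kolmogorov

/-! ### Characteristic functions of infinitely divisible laws -/

section CharFun

open scoped InnerProductSpace

variable {E : Type*} [NormedAddCommGroup E] [InnerProductSpace ℝ E]
  [MeasurableSpace E] [BorelSpace E]

/-- `φ` is the characteristic function of a probability measure. -/
def IsCharFun (φ : E → ℂ) : Prop :=
  ∃ μ : Measure E, IsProbabilityMeasure μ ∧ charFun μ = φ

namespace IsCharFun

lemma exp_inner (a : E) : IsCharFun fun z : E => Complex.exp (⟪a, z⟫_ℝ * Complex.I) :=
  ⟨Measure.dirac a, inferInstance, by ext z; rw [charFun_dirac]⟩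

variable [FiniteDimensional ℝ E]

lemma mul {φ φ' : E → ℂ} (h : IsCharFun φ) (h' : IsCharFun φ') :
    IsCharFun fun z => φ z * φ' z := by
  obtain ⟨μ, hμ, rfl⟩ := h
  obtain ⟨μ', hμ', rfl⟩ := h'
  exact ⟨μ ∗ μ', inferInstance, by ext z; rw [charFun_conv]⟩

lemma pow {φ : E → ℂ} (h : IsCharFun φ) (n : ℕ) : IsCharFun fun z => φ z ^ n := by
  induction n with
  | zero => simpa using exp_inner (0 : E)
  | succ n ih => simpa only [pow_succ] using ih.mul h

/-- Lévy's continuity theorem, existence part: continuity of f at 0 forces tightness, Prokhorov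
gives a weakly convergent subsequence, and the characteristic function of its limit must be f. -/
lemma of_tendsto {φ : ℕ → E → ℂ} {f : E → ℂ} (h : ∀ n, IsCharFun (φ n))
    (hf : ContinuousAt f 0) (hlim : ∀ t, Tendsto (fun n => φ n t) atTop (𝓝 (f t))) :
    IsCharFun f := by
  choose μ hμ hφ using h
  simp_rw [← hφ] at hlim
  let ρ : ℕ → ProbabilityMeasure E := fun n => ⟨μ n, hμ n⟩
  have htight : IsTightMeasureSet {((m : ProbabilityMeasure E) : Measure E) | m ∈ Set.range ρ} := by
    refine (isTightMeasureSet_of_tendsto_charFun hf hlim).subset ?_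
    rintro _ ⟨_, ⟨n, rfl⟩, rfl⟩
    exact ⟨n, rfl⟩
  obtain ⟨m, -, k, hk, hm⟩ := (isCompact_closure_of_isTightMeasureSet htight).isSeqCompact
    fun n => subset_closure ⟨n, rfl⟩
  refine ⟨m, inferInstance, ?_⟩
  ext t
  exact tendsto_nhds_unique (ProbabilityMeasure.tendsto_iff_tendsto_charFun.1 hm t)
    ((hlim t).comp hk.tendsto_atTop)

/-- Compound Poisson laws. -/
lemma exp_integral_exp_sub_one (m : Measure E) [IsFiniteMeasure m] :
    IsCharFun fun z : E => Complex.exp (∫ y, (Complex.exp (⟪y, z⟫_ℝ * Complex.I) - 1) ∂m) := by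
  have hint (z : E) : Integrable (fun y : E => Complex.exp (⟪y, z⟫_ℝ * Complex.I)) m :=
    (integrable_const (1 : ℝ)).mono' (by fun_prop) (by simp [Complex.norm_exp_ofReal_mul_I])
  have hw (z : E) : ∫ y, (Complex.exp (⟪y, z⟫_ℝ * Complex.I) - 1) ∂m =
      charFun m z - m.real Set.univ := by
    rw [integral_sub (hint z) (integrable_const _), charFun_apply]
    simp
  simp_rw [hw]
  -- With N = n + k + 1 ≥ m(E), the mixture (1 - m(E)/N) δ₀ + m/N is a probability measure. The N-th
  -- powers of its characteristic function 1 + (m̂ - m(E))/N converge to exp(m̂ - m(E)).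
  obtain ⟨k, hk⟩ := exists_nat_ge (m.real Set.univ)
  have hpos (n : ℕ) : (0 : ℝ) < (n + (k + 1) : ℕ) := by positivity
  have hle (n : ℕ) : m.real Set.univ / (n + (k + 1) : ℕ) ≤ 1 := by
    rw [div_le_one (hpos n)]
    push_cast
    linarith [n.cast_nonneg (α := ℝ)]
  have hmix (n : ℕ) : IsCharFun fun z : E =>
      1 + (charFun m z - m.real Set.univ) / (n + (k + 1) : ℕ) := by
    refine ⟨ENNReal.ofReal (1 - m.real Set.univ / (n + (k + 1) : ℕ)) • Measure.dirac 0 +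
      ENNReal.ofReal (1 / (n + (k + 1) : ℕ)) • m, ⟨?_⟩, ?_⟩
    · rw [Measure.add_apply, Measure.smul_apply, Measure.smul_apply, measure_univ, smul_eq_mul,
        smul_eq_mul, mul_one, ← ofReal_measureReal, ← ENNReal.ofReal_mul (by positivity),
        ← ENNReal.ofReal_add (sub_nonneg.2 (hle n)) (by positivity)]
      simp only [one_div, ENNReal.ofReal_eq_one]
      field_simp
      ring
    · ext z
      rw [charFun_apply, integral_add_measure, integral_smul_measure, integral_smul_measure,
        ← charFun_apply, ← charFun_apply, charFun_dirac,
        ENNReal.toReal_ofReal (sub_nonneg.2 (hle n)), ENNReal.toReal_ofReal (by positivity)]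
      · simp only [inner_zero_left, Complex.ofReal_zero, zero_mul, Complex.exp_zero,
          Complex.real_smul]
        push_cast
        ring
      · exact ((integrable_const (1 : ℝ)).mono' (by fun_prop)
          (by simp [Complex.norm_exp_ofReal_mul_I])).smul_measure ENNReal.ofReal_ne_top
      · exact (hint z).smul_measure ENNReal.ofReal_ne_top
  refine of_tendsto (fun n => (hmix n).pow (n + (k + 1))) ?_ fun z => ?_
  · exact (Complex.continuous_exp.comp (continuous_charFun.sub continuous_const)).continuousAt
  · exact (Complex.tendsto_one_add_div_pow_exp _).comp (tendsto_add_atTop_nat (k + 1))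

/-- Gaussian laws whose covariance is the Gram matrix of square integrable functions. -/
lemma exp_neg_integral_inner_sq {ι : Type*} [Fintype ι] {X : Type*} [MeasurableSpace X]
    {μ : Measure X} {F : X → EuclideanSpace ℝ ι} (hF : ∀ i, MemLp (fun x => F x i) 2 μ)
    {σ2 : ℝ} (hσ : 0 ≤ σ2) :
    IsCharFun fun z => Complex.exp (-(σ2 * (∫ x, ⟪F x, z⟫_ℝ ^ 2 ∂μ : ℝ) / 2)) := by
  classical
  let S : Matrix ι ι ℝ := Matrix.of fun i j => σ2 * ∫ x, F x i * F x j ∂μ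
  have hquad (z : ι → ℝ) : z ⬝ᵥ S.mulVec z = σ2 * ∫ x, (∑ i, z i * F x i) ^ 2 ∂μ := by
    have hij (i j : ι) : Integrable (fun x => z i * F x i * (z j * F x j)) μ :=
      ((hF i).const_mul (z i)).integrable_mul ((hF j).const_mul (z j))
    simp_rw [pow_two, Finset.sum_mul_sum]
    rw [integral_finsetSum _ fun i _ => integrable_finsetSum _ fun j _ => hij i j, Finset.mul_sum]
    refine Finset.sum_congr rfl fun i _ => ?_
    rw [integral_finsetSum _ fun j _ => hij i j, Matrix.mulVec, dotProduct, Finset.mul_sum,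
      Finset.mul_sum]
    refine Finset.sum_congr rfl fun j _ => ?_
    simp only [S, Matrix.of_apply]
    rw [← integral_const_mul, ← integral_mul_const, ← integral_const_mul, ← integral_const_mul]
    congr 1 with x
    ring
  have hS : S.PosSemidef := by
    refine Matrix.PosSemidef.of_dotProduct_mulVec_nonneg ?_ fun z => ?_
    · ext i j
      simp [S, mul_comm]
    · rw [star_trivial, hquad]
      exact mul_nonneg hσ (integral_nonneg fun x => sq_nonneg _)
  refine ⟨ProbabilityTheory.multivariateGaussian 0 S, inferInstance, ?_⟩
  ext z
  rw [ProbabilityTheory.charFun_multivariateGaussian hS, hquad]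
  simp only [inner_zero_right, PiLp.inner_apply]
  congr 1
  simp

end IsCharFun

end CharFun

/-! ### Finite-dimensional laws of the noise -/

section FiniteDimensionalLaws

open scoped InnerProductSpace

namespace CharacteristicTriplet

variable (T : CharacteristicTriplet) {X : Type*} [MeasurableSpace X] {μ : Measure X}

/-- Markov's inequality for min{1, s²} at level min{1, ε²}. -/
lemma measure_lt_abs_lt_top {ε : ℝ} (hε : 0 < ε) : T.ν {s | ε < |s|} < ∞ := by
  have h1 : 0 < min 1 (ε ^ 2) := by positivity
  refine lt_of_le_of_lt ?_ (ENNReal.div_lt_top T.lintegral_lt_top.ne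
    (ENNReal.ofReal_pos.2 h1).ne')
  rw [ENNReal.le_div_iff_mul_le (Or.inl (ENNReal.ofReal_pos.2 h1).ne')
    (Or.inl ENNReal.ofReal_ne_top), mul_comm]
  have hm : AEMeasurable (fun s : ℝ => ENNReal.ofReal (min 1 (s ^ 2))) T.ν := by fun_prop
  refine le_trans ?_ (mul_meas_ge_le_lintegral₀ hm (ENNReal.ofReal (min 1 (ε ^ 2))))
  gcongr with s
  intro hs
  have h2 : ε ^ 2 ≤ s ^ 2 := by
    rw [← sq_abs s]
    exact pow_le_pow_left₀ hε.le (le_of_lt hs) 2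
  exact ENNReal.ofReal_le_ofReal (min_le_min_left 1 h2)

lemma integrable_prod_jumpIntegrand [SFinite μ] [SFinite T.ν]
    (hT : ∫⁻ s in {s : ℝ | 1 < |s|}, ENNReal.ofReal |s| ∂T.ν < ∞) {g : X → ℝ}
    (hg : Measurable g) (h1 : Integrable g μ) (h2 : MemLp g 2 μ) :
    Integrable (fun p : X × ℝ => jumpIntegrand (g p.1) p.2) (μ.prod T.ν) :=
  (((h2.integrable_sq.add h1.norm).const_mul 2).mul_prod (T.integrable_jumpWeight hT)).mono'
    (measurable_jumpIntegrand.comp (by fun_prop : Measurable fun p : X × ℝ =>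
      (g p.1, p.2))).aestronglyMeasurable
    (Eventually.of_forall fun p => norm_jumpIntegrand_le _ _)

variable {E : Type*} [NormedAddCommGroup E] [InnerProductSpace ℝ E] [FiniteDimensional ℝ E]
  [MeasurableSpace E] [BorelSpace E]

/-- A finite part of the jump measure contributes a compound Poisson law with a drift. -/
lemma isCharFun_exp_integral_jumpIntegrand_of_finite {F : X → E} (hF : Measurable F)
    (ρ : Measure (X × ℝ)) [IsFiniteMeasure ρ] (h1 : Integrable (fun p => F p.1) ρ) :
    IsCharFun fun z : E => Complex.exp (∫ p, jumpIntegrand ⟪F p.1, z⟫_ℝ p.2 ∂ρ) := by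
  -- The jumps are the vectors s F(x). The compensator integrates to ⟨∫ a, z⟩, so it is a
  -- deterministic shift by -∫ a.
  let a : X × ℝ → E := fun p => ({s : ℝ | |s| ≤ 1}.indicator id p.2) • F p.1
  have hind : Measurable fun p : X × ℝ => {s : ℝ | |s| ≤ 1}.indicator id p.2 :=
    (measurable_id.indicator (measurableSet_le (by fun_prop) measurable_const)).comp measurable_snd
  have ha : Integrable a ρ := by
    refine h1.norm.mono' (hind.smul (hF.comp measurable_fst)).aestronglyMeasurable
      (Eventually.of_forall fun p => ?_)
    simp only [a, norm_smul]
    refine mul_le_of_le_one_left (norm_nonneg _) ?_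
    by_cases hs : |p.2| ≤ 1
    · rw [Set.indicator_of_mem (by exact hs)]
      exact hs
    · rw [Set.indicator_of_notMem (by exact hs)]
      simp
  have hmeas : Measurable fun p : X × ℝ => p.2 • F p.1 :=
    measurable_snd.smul (hF.comp measurable_fst)
  have hcp := IsCharFun.exp_integral_exp_sub_one (ρ.map fun p => p.2 • F p.1)
  convert hcp.mul (IsCharFun.exp_inner (-∫ p, a p ∂ρ)) using 2 with z
  rw [← Complex.exp_add, integral_map hmeas.aemeasurable
    (by fun_prop : Continuous fun y : E => Complex.exp (⟪y, z⟫_ℝ * Complex.I) - 1).aestronglyMeasurable]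
  have hexp : Integrable (fun p : X × ℝ =>
      Complex.exp (⟪p.2 • F p.1, z⟫_ℝ * Complex.I) - 1) ρ := by
    refine ((integrable_const (1 : ℝ)).mono' ?_ ?_).sub (integrable_const _)
    · exact ((by fun_prop : Continuous fun y : E =>
        Complex.exp (⟪y, z⟫_ℝ * Complex.I)).measurable.comp hmeas).aestronglyMeasurable
    · simp [Complex.norm_exp_ofReal_mul_I]
  have hdrift : ((⟪-∫ p, a p ∂ρ, z⟫_ℝ : ℝ) : ℂ) * Complex.I =
      -∫ p, ((⟪a p, z⟫_ℝ : ℝ) : ℂ) * Complex.I ∂ρ := by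
    rw [integral_mul_const, integral_complex_ofReal, inner_neg_left, real_inner_comm, ← integral_inner ha z]
    simp_rw [real_inner_comm z]
    push_cast
    ring
  have hi : Integrable (fun p => ((⟪a p, z⟫_ℝ : ℝ) : ℂ) * Complex.I) ρ :=
    (ha.inner_const z).ofReal.mul_const _
  rw [hdrift, ← sub_eq_add_neg, ← integral_sub hexp hi]
  congr 2 with p
  rw [jumpIntegrand]
  by_cases hs : |p.2| ≤ 1
  · simp only [a, Set.indicator_of_mem (show p.2 ∈ {s : ℝ | |s| ≤ 1} from hs), id,
      real_inner_smul_left]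
    push_cast
    ring_nf
  · simp only [a, Set.indicator_of_notMem (show p.2 ∉ {s : ℝ | |s| ≤ 1} from hs),
      real_inner_smul_left]
    push_cast
    ring_nf

/-- Exhaust the product space by sets of finite measure, cutting off small jumps and restricting x
to spanning sets. Each piece is a shifted compound Poisson law, and the integrals converge because
the integrand is absolutely integrable. The exhaustion misses only s = 0, where the integrand
vanishes. -/
lemma isCharFun_exp_integral_jumpIntegrand [SigmaFinite μ] [SFinite T.ν]
    (hT : ∫⁻ s in {s : ℝ | 1 < |s|}, ENNReal.ofReal |s| ∂T.ν < ∞) {F : X → E} (hF : Measurable F)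
    (h1 : Integrable F μ) (h2 : MemLp F 2 μ) :
    IsCharFun fun z : E =>
      Complex.exp (∫ p, jumpIntegrand ⟪F p.1, z⟫_ℝ p.2 ∂(μ.prod T.ν)) := by
  let A : ℕ → Set (X × ℝ) := fun k => spanningSets μ k ×ˢ {s : ℝ | 1 / ((k : ℝ) + 1) < |s|}
  have hAm (k : ℕ) : MeasurableSet (A k) :=
    (measurableSet_spanningSets μ k).prod (measurableSet_lt measurable_const (by fun_prop))
  have hAmono : Monotone A := fun m n hmn => by
    refine Set.prod_mono (monotone_spanningSets μ hmn) fun s hs => ?_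
    exact lt_of_le_of_lt (Nat.one_div_le_one_div hmn) (Set.mem_ofPred.1 hs)
  have hint (z : E) : Integrable (fun p : X × ℝ => jumpIntegrand ⟪F p.1, z⟫_ℝ p.2)
      (μ.prod T.ν) :=
    T.integrable_prod_jumpIntegrand (g := fun x => ⟪F x, z⟫_ℝ) hT (by fun_prop) (h1.inner_const z)
      (h2.inner_const z)
  refine IsCharFun.of_tendsto (φ := fun k z =>
    Complex.exp (∫ p in A k, jumpIntegrand ⟪F p.1, z⟫_ℝ p.2 ∂(μ.prod T.ν))) (fun k => ?_) ?_
    fun z => ?_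
  · have hν := T.measure_lt_abs_lt_top (ε := 1 / ((k : ℝ) + 1)) (by positivity)
    have hfin : (μ.prod T.ν) (A k) < ∞ := by
      rw [Measure.prod_prod]
      exact ENNReal.mul_lt_top (measure_spanningSets_lt_top μ k) hν
    have : IsFiniteMeasure ((μ.prod T.ν).restrict (A k)) := isFiniteMeasure_restrict.2 hfin.ne
    refine isCharFun_exp_integral_jumpIntegrand_of_finite hF _ ?_
    have : IsFiniteMeasure (T.ν.restrict {s : ℝ | 1 / ((k : ℝ) + 1) < |s|}) :=
      isFiniteMeasure_restrict.2 hν.ne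
    rw [← Measure.prod_restrict]
    exact h1.restrict.comp_fst _
  -- The continuity at 0 required by the continuity theorem: Cauchy–Schwarz gives a majorant that is
  -- a polynomial in ‖z‖ without constant term.
  · have hbound (z : E) : ‖∫ p, jumpIntegrand ⟪F p.1, z⟫_ℝ p.2 ∂(μ.prod T.ν)‖ ≤
        ∫ p : X × ℝ, 2 * ((‖F p.1‖ ^ 2) * ‖z‖ ^ 2 + ‖F p.1‖ * ‖z‖) * jumpWeight p.2 ∂(μ.prod T.ν) := by
      refine norm_integral_le_of_norm_le ((((h2.integrable_norm_pow two_ne_zero).mul_const _).add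
        (h1.norm.mul_const _)).const_mul 2 |>.mul_prod (T.integrable_jumpWeight hT))
        (Eventually.of_forall fun p => (norm_jumpIntegrand_le _ _).trans ?_)
      have := abs_real_inner_le_norm (F p.1) z
      have h3 := jumpWeight_nonneg p.2
      rw [← sq_abs, ← mul_pow]
      gcongr
    have hlim : ContinuousAt (fun z : E => ∫ p, jumpIntegrand ⟪F p.1, z⟫_ℝ p.2 ∂(μ.prod T.ν)) 0 := by
      have h0 : ∫ p, jumpIntegrand ⟪F p.1, (0 : E)⟫_ℝ p.2 ∂(μ.prod T.ν) = 0 := by simp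
      rw [ContinuousAt, h0]
      refine squeeze_zero_norm hbound ?_
      have h4 (z : E) : ∫ p : X × ℝ, 2 * ((‖F p.1‖ ^ 2) * ‖z‖ ^ 2 + ‖F p.1‖ * ‖z‖) *
          jumpWeight p.2 ∂(μ.prod T.ν) =
          2 * ((∫ x, ‖F x‖ ^ 2 ∂μ) * ‖z‖ ^ 2 + (∫ x, ‖F x‖ ∂μ) * ‖z‖) *
            ∫ s, jumpWeight s ∂T.ν := by
        rw [integral_prod_mul (fun x => 2 * ((‖F x‖ ^ 2) * ‖z‖ ^ 2 + ‖F x‖ * ‖z‖)) jumpWeight,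
          integral_const_mul, integral_add ((h2.integrable_norm_pow two_ne_zero).mul_const _)
          (h1.norm.mul_const _), integral_mul_const, integral_mul_const]
      simp_rw [h4]
      refine Continuous.tendsto' (by fun_prop) _ _ (by simp)
    exact (Complex.continuous_exp.continuousAt (x := _)).comp hlim
  · refine (Complex.continuous_exp.tendsto _).comp ?_
    have hlim := tendsto_setIntegral_of_monotone hAm hAmono (hint z).integrableOn
    rwa [setIntegral_eq_integral_of_forall_compl_eq_zero fun p hp => ?_] at hlim
    by_cases hs : p.2 = 0
    · simp [hs]
    · exfalso
      refine hp ?_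
      obtain ⟨k, hk⟩ := exists_nat_one_div_lt (abs_pos.2 hs)
      have hx : p.1 ∈ ⋃ n, spanningSets μ n := by rw [iUnion_spanningSets]; trivial
      obtain ⟨n, hn⟩ := Set.mem_iUnion.1 hx
      refine Set.mem_iUnion.2 ⟨max n k, monotone_spanningSets μ (le_max_left _ _) hn, ?_⟩
      exact lt_of_le_of_lt (Nat.one_div_le_one_div (le_max_right _ _)) hk

/-- For integrable and square integrable `F`, the function `z ↦ exp (∫ ψ(⟨F(x), z⟩) dx)` is the
characteristic function of a probability measure. -/
theorem isCharFun_exp_integral_psi [SigmaFinite μ]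
    (hT : ∫⁻ s in {s : ℝ | 1 < |s|}, ENNReal.ofReal |s| ∂T.ν < ∞) {ι : Type*} [Fintype ι]
    {F : X → EuclideanSpace ℝ ι} (hF : Measurable F) (h1 : Integrable F μ) (h2 : MemLp F 2 μ) :
    IsCharFun fun z : EuclideanSpace ℝ ι => Complex.exp (∫ x, T.psi ⟪F x, z⟫_ℝ ∂μ) := by
  have := T.sigmaFinite
  have hgauss := IsCharFun.exp_neg_integral_inner_sq (μ := μ) (F := F)
    (fun i => (EuclideanSpace.proj (𝕜 := ℝ) i).comp_memLp' h2) T.sigmaSq_nonneg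
  have hdrift := IsCharFun.exp_inner (T.b • ∫ x, F x ∂μ)
  -- The three summands of ψ give three independent components; Fubini identifies the integral over
  -- μ ⊗ ν with the iterated one.
  convert (hdrift.mul hgauss).mul (T.isCharFun_exp_integral_jumpIntegrand hT hF h1 h2)
    using 2 with z
  have hz1 : Integrable (fun x => ⟪F x, z⟫_ℝ) μ := h1.inner_const z
  have hz2 : MemLp (fun x => ⟪F x, z⟫_ℝ) 2 μ := h2.inner_const z
  have hJ := T.integrable_prod_jumpIntegrand hT (by fun_prop) hz1 hz2
  rw [← Complex.exp_add, ← Complex.exp_add, integral_prod _ hJ]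
  congr 1
  have hi1 : Integrable (fun x => Complex.I * T.b * (⟪F x, z⟫_ℝ : ℂ)) μ :=
    hz1.ofReal.const_mul _
  have hi2 : Integrable (fun x => T.sigmaSq * (⟪F x, z⟫_ℝ : ℂ) ^ 2 / 2) μ := by
    have := (hz2.integrable_sq.ofReal (𝕜 := ℂ)).const_mul (T.sigmaSq : ℂ)
    simpa using this.div_const 2
  unfold psi
  have hi3 : Integrable (fun x => Complex.I * T.b * (⟪F x, z⟫_ℝ : ℂ) -
      T.sigmaSq * (⟪F x, z⟫_ℝ : ℂ) ^ 2 / 2) μ := hi1.sub hi2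
  have hi4 : Integrable (fun x => ∫ s, jumpIntegrand ⟪F x, z⟫_ℝ s ∂T.ν) μ := hJ.integral_prod_left
  rw [integral_add hi3 hi4, integral_sub hi1 hi2]
  congr 1
  rw [sub_eq_add_neg, integral_const_mul, integral_div, integral_const_mul]
  congr 1
  · rw [integral_complex_ofReal, real_inner_smul_left, real_inner_comm, ← integral_inner h1 z]
    simp_rw [real_inner_comm z]
    push_cast
    ring
  · rw [← integral_complex_ofReal]
    push_cast
    rfl

end CharacteristicTriplet

end FiniteDimensionalLaws

/-! ### Existence, uniqueness and continuity of Lévy noise fields -/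

section Field

/-- Finite measures on `ι → ℝ` are determined by their Fourier transforms. -/
lemma measure_pi_ext_of_integral_exp {ι : Type*} [Fintype ι] {μ ν : Measure (ι → ℝ)}
    [IsFiniteMeasure μ] [IsFiniteMeasure ν]
    (h : ∀ z : ι → ℝ, ∫ x, Complex.exp (Complex.I * (∑ i, z i * x i : ℝ)) ∂μ =
      ∫ x, Complex.exp (Complex.I * (∑ i, z i * x i : ℝ)) ∂ν) : μ = ν := by
  classical
  refine Measure.ext_of_charFunDual ?_
  ext L
  have hL (x : ι → ℝ) : L x = ∑ i, L (Pi.single i 1) * x i := by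
    have := LinearMap.pi_apply_eq_sum_univ (L : (ι → ℝ) →ₗ[ℝ] ℝ) x
    simp only [smul_eq_mul, ContinuousLinearMap.coe_coe] at this
    rw [this]
    refine Finset.sum_congr rfl fun i _ => ?_
    rw [mul_comm]
    congr 2
    ext j
    rw [Pi.single_apply]
    exact if_congr eq_comm rfl rfl
  simpa only [charFunDual_apply, ← hL, mul_comm Complex.I] using h fun i => L (Pi.single i 1)

/-- Characteristic functions are positive definite. -/
lemma posSemidef_charFun_sub {E : Type*} [NormedAddCommGroup E] [InnerProductSpace ℝ E]
    [MeasurableSpace E] [BorelSpace E] (μ : Measure E) [IsFiniteMeasure μ]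
    {ι : Type*} [Fintype ι] (t : ι → E) :
    (Matrix.of fun i j => charFun μ (t i - t j)).PosSemidef := by
  refine Matrix.PosSemidef.of_dotProduct_mulVec_nonneg ?_ fun c => ?_
  · ext i j
    rw [Matrix.conjTranspose_apply, Matrix.of_apply, Matrix.of_apply, ← neg_sub (t i) (t j),
      charFun_neg]
    simp
  -- The quadratic form at c equals ∫ |w|² dμ.
  · let w : E → ℂ := fun y => ∑ i, star (c i) * Complex.exp (inner ℝ y (t i) * Complex.I)
    have hint (i j : ι) : Integrable (fun y : E => star (c i) *
        (Complex.exp (inner ℝ y (t i - t j) * Complex.I) * c j)) μ := by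
      refine Integrable.const_mul (Integrable.mul_const ?_ _) _
      exact (integrable_const (1 : ℝ)).mono'
        (by fun_prop : Continuous fun y : E =>
          Complex.exp (inner ℝ y (t i - t j) * Complex.I)).measurable.aestronglyMeasurable
        (by simp [Complex.norm_exp_ofReal_mul_I])
    have hw (y : E) : ((Complex.normSq (w y) : ℝ) : ℂ) = ∑ i, ∑ j, star (c i) *
        (Complex.exp (inner ℝ y (t i - t j) * Complex.I) * c j) := by
      rw [← Complex.mul_conj, map_sum, Finset.sum_mul_sum]
      refine Finset.sum_congr rfl fun i _ => Finset.sum_congr rfl fun j _ => ?_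
      have hexp : Complex.exp (inner ℝ y (t i - t j) * Complex.I) =
          Complex.exp (inner ℝ y (t i) * Complex.I) *
            Complex.exp (inner ℝ y (t j) * -Complex.I) := by
        rw [← Complex.exp_add, inner_sub_right]
        push_cast
        ring_nf
      rw [map_mul, ← Complex.exp_conj, hexp]
      simp only [map_mul, Complex.conj_ofReal, Complex.conj_I, RCLike.star_def, Complex.conj_conj]
      ring
    have hsum : star c ⬝ᵥ (Matrix.of fun i j => charFun μ (t i - t j)).mulVec c =
        ((∫ y, Complex.normSq (w y) ∂μ : ℝ) : ℂ) := by
      rw [← integral_complex_ofReal]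
      simp_rw [hw]
      rw [integral_finsetSum _ fun i _ => integrable_finsetSum _ fun j _ => hint i j, dotProduct]
      refine Finset.sum_congr rfl fun i _ => ?_
      rw [integral_finsetSum _ fun j _ => hint i j, Matrix.mulVec, dotProduct, Finset.mul_sum]
      refine Finset.sum_congr rfl fun j _ => ?_
      rw [integral_const_mul, integral_mul_const, Matrix.of_apply, charFun_apply]
      rfl
    rw [hsum]
    exact_mod_cast integral_nonneg fun y => Complex.normSq_nonneg _

/-! ### Consistency of the finite-dimensional laws and their projective limit. -/

section Projective

variable {V : Type*} [AddCommGroup V] [Module ℝ V] {φ : V → ℂ} {P : ∀ J : Finset V, Measure (J → ℝ)}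

/-- Finite-dimensional laws whose Fourier transforms come from a functional are consistent. -/
lemma isProjectiveMeasureFamily_of_integral_exp [∀ J, IsProbabilityMeasure (P J)]
    (hP : ∀ (J : Finset V) (z : J → ℝ),
      ∫ x, Complex.exp (Complex.I * (∑ i, z i * x i : ℝ)) ∂(P J) = φ (∑ i, z i • (i : V))) :
    IsProjectiveMeasureFamily (α := fun _ : V => ℝ) P := by
  classical
  intro I J hJI
  have hm : Measurable (Finset.restrict₂ (π := fun _ : V => ℝ) hJI) :=
    Finset.measurable_restrict₂ hJI
  have := Measure.isProbabilityMeasure_map (μ := P I) hm.aemeasurable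
  refine measure_pi_ext_of_integral_exp fun z => ?_
  rw [hP, integral_map hm.aemeasurable
    (by fun_prop : Continuous fun x : J → ℝ =>
      Complex.exp (Complex.I * (∑ i, z i * x i : ℝ))).aestronglyMeasurable]
  -- Extending z by zero from J to I changes neither the pairing nor the vector at which φ is
  -- evaluated.
  let c : I → ℝ := fun i => if h : (i : V) ∈ J then z ⟨i, h⟩ else 0
  let e : J → I := fun j => ⟨j, hJI j.2⟩
  have he : Function.Injective e := fun a b hab => Subtype.ext (congrArg (fun i : I => i.1) hab)
  have hc (i : I) (hi : i ∉ Set.range e) : c i = 0 :=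
    dif_neg fun h => hi ⟨⟨i, h⟩, rfl⟩
  have hce (j : J) : c (e j) = z j := dif_pos j.2
  have hsum : ∑ j, z j • (j : V) = ∑ i, c i • (i : V) :=
    Fintype.sum_of_injective e he _ _ (fun i hi => by rw [hc i hi, zero_smul])
      fun j => by rw [hce]
  have hsum' (x : I → ℝ) : ∑ j, z j * Finset.restrict₂ (π := fun _ : V => ℝ) hJI x j =
      ∑ i, c i * x i :=
    Fintype.sum_of_injective e he _ _ (fun i hi => by rw [hc i hi, zero_mul])
      fun j => by rw [hce]; rfl
  simp_rw [hsum, ← hP, hsum']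

/-- Only the coordinates in the support of l matter. Since l is formal, the coordinates ω need not
respect linear relations in V, while the right-hand side depends only on the value of l in V; this
is what forces almost sure linearity. -/
lemma integral_exp_linearCombination_of_isProjectiveLimit
    (hP : ∀ (J : Finset V) (z : J → ℝ),
      ∫ x, Complex.exp (Complex.I * (∑ i, z i * x i : ℝ)) ∂(P J) = φ (∑ i, z i • (i : V)))
    {μ : Measure (V → ℝ)} (hμ : IsProjectiveLimit (α := fun _ : V => ℝ) μ P) (l : V →₀ ℝ) :
    ∫ ω, Complex.exp (Complex.I * (Finsupp.linearCombination ℝ ω l : ℝ)) ∂μ =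
      φ (Finsupp.linearCombination ℝ id l) := by
  have hm : Measurable (l.support.restrict (π := fun _ : V => ℝ)) :=
    Finset.measurable_restrict l.support
  have h := hP l.support fun i => l i
  rw [← hμ l.support, integral_map hm.aemeasurable
    (by fun_prop : Continuous fun x : l.support → ℝ =>
      Complex.exp (Complex.I * (∑ i : l.support, l i * x i : ℝ))).aestronglyMeasurable] at h
  have hr : Finsupp.linearCombination ℝ id l = ∑ i : l.support, l i • (i : V) := by
    rw [Finsupp.linearCombination_apply, Finsupp.sum]
    exact (Finset.sum_coe_sort l.support fun f => l f • f).symm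
  have hr' (ω : V → ℝ) : Finsupp.linearCombination ℝ ω l =
      ∑ i : l.support, l i * l.support.restrict ω i := by
    rw [Finsupp.linearCombination_apply, Finsupp.sum]
    exact (Finset.sum_coe_sort l.support fun f => l f * ω f).symm
  simp_rw [hr, ← h, hr']

end Projective

/-! ### Fourier transforms and laws of almost surely linear fields. -/

section RandomField

variable {V : Type*} [AddCommGroup V] [Module ℝ V] {Ω : Type*} [MeasurableSpace Ω]
  {P : Measure Ω} {Z : V → Ω → ℝ}

lemma ae_map_sum_smul
    (hlin : ∀ (α β : ℝ) (f g : V), ∀ᵐ ω ∂P, Z (α • f + β • g) ω = α * Z f ω + β * Z g ω)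
    {ι : Type*} (s : Finset ι) (c : ι → ℝ) (f : ι → V) :
    ∀ᵐ ω ∂P, Z (∑ i ∈ s, c i • f i) ω = ∑ i ∈ s, c i * Z (f i) ω := by
  classical
  induction s using Finset.induction_on with
  | empty => simpa using hlin 0 0 0 0
  | insert a s ha ih =>
    filter_upwards [ih, hlin (c a) 1 (f a) (∑ i ∈ s, c i • f i)] with ω h1 h2
    rw [Finset.sum_insert ha, Finset.sum_insert ha, ← h1]
    simpa using h2

lemma ae_map_sub
    (hlin : ∀ (α β : ℝ) (f g : V), ∀ᵐ ω ∂P, Z (α • f + β • g) ω = α * Z f ω + β * Z g ω)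
    (f g : V) : ∀ᵐ ω ∂P, Z (f - g) ω = Z f ω - Z g ω := by
  filter_upwards [hlin 1 (-1) f g] with ω h
  simpa [sub_eq_add_neg] using h

/-- The Fourier transform of the finite-dimensional distributions of a random field. -/
lemma integral_exp_map_pi (hm : ∀ f, Measurable (Z f))
    (hlin : ∀ (α β : ℝ) (f g : V), ∀ᵐ ω ∂P, Z (α • f + β • g) ω = α * Z f ω + β * Z g ω)
    {ι : Type*} [Fintype ι] (f : ι → V) (z : ι → ℝ) :
    ∫ x, Complex.exp (Complex.I * (∑ i, z i * x i : ℝ)) ∂(P.map fun ω i => Z (f i) ω) =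
      fieldFourierTransform P Z (∑ i, z i • f i) := by
  rw [integral_map (measurable_pi_lambda _ fun i => hm (f i)).aemeasurable
    (by fun_prop : Continuous fun x : ι → ℝ =>
      Complex.exp (Complex.I * (∑ i, z i * x i : ℝ))).aestronglyMeasurable]
  refine integral_congr_ae ?_
  filter_upwards [ae_map_sum_smul hlin Finset.univ z f] with ω h
  rw [h]

/-- Linear random fields with the same Fourier transform are equivalent in law. -/
theorem equivalentInLaw_of_fieldFourierTransform_eq {Ω' : Type*} [MeasurableSpace Ω']
    {P' : Measure Ω'} {Z' : V → Ω' → ℝ} [IsFiniteMeasure P] [IsFiniteMeasure P']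
    (hm : ∀ f, Measurable (Z f)) (hm' : ∀ f, Measurable (Z' f))
    (hlin : ∀ (α β : ℝ) (f g : V), ∀ᵐ ω ∂P, Z (α • f + β • g) ω = α * Z f ω + β * Z g ω)
    (hlin' : ∀ (α β : ℝ) (f g : V), ∀ᵐ ω ∂P', Z' (α • f + β • g) ω = α * Z' f ω + β * Z' g ω)
    (h : fieldFourierTransform P Z = fieldFourierTransform P' Z') :
    EquivalentInLaw P Z P' Z' := by
  intro n f A hA
  have hlaw : (P.map fun ω i => Z (f i) ω) = P'.map fun ω i => Z' (f i) ω :=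
    measure_pi_ext_of_integral_exp fun z => by
      rw [integral_exp_map_pi hm hlin, integral_exp_map_pi hm' hlin', h]
  have hB : MeasurableSet (Set.univ.pi A) := MeasurableSet.univ_pi hA
  have h1 := congrArg (fun m => m (Set.univ.pi A)) hlaw
  simp only [Measure.map_apply (measurable_pi_lambda _ fun i => hm (f i)) hB,
    Measure.map_apply (measurable_pi_lambda _ fun i => hm' (f i)) hB] at h1
  simpa [Set.preimage, Set.mem_pi] using h1

end RandomField

/-! ### Construction and mixed-norm continuity of the Lévy noise field. -/

namespace CharacteristicTriplet

variable (T : CharacteristicTriplet) {d : ℕ}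

/-- The finite-dimensional distributions of the noise field exist. -/
lemma exists_charFun_eq_levyFunctional
    (hT : ∫⁻ s in {s : ℝ | 1 < |s|}, ENNReal.ofReal |s| ∂T.ν < ∞) {ι : Type*} [Fintype ι]
    (f : ι → TestSpace d) :
    IsCharFun fun z : EuclideanSpace ℝ ι => T.levyFunctional (∑ i, z i • f i) := by
  have h := T.isCharFun_exp_integral_psi hT (μ := (volume : Measure (EuclideanSpace ℝ (Fin d))))
    (F := fun x => WithLp.toLp 2 fun i => f i x) ?_ ?_ ?_
  · convert h using 2 with z
    rw [levyFunctional]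
    congr 2 with x
    rw [sum_apply, PiLp.inner_apply]
    simp
  · exact (WithLp.measurable_toLp 2 _).comp
      (measurable_pi_lambda _ fun i => (f i).continuous.measurable)
  · exact integrable_piLp_iff.2 fun i => (f i).integrable
  · exact MemLp.of_eval_piLp fun i => (f i).memLp 2

/-- The joint law attached to (fᵢ) has characteristic function z ↦ φ(∑ zᵢ fᵢ). At eᵢ - eⱼ, a
difference of basis vectors, it gives the matrix entries. -/
lemma posSemidef_levyFunctional
    (hT : ∫⁻ s in {s : ℝ | 1 < |s|}, ENNReal.ofReal |s| ∂T.ν < ∞) {ι : Type*} [Fintype ι]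
    (f : ι → TestSpace d) :
    (Matrix.of fun i j => T.levyFunctional (f i - f j)).PosSemidef := by
  classical
  obtain ⟨μ, hμ, h⟩ := T.exists_charFun_eq_levyFunctional hT f
  convert posSemidef_charFun_sub μ fun i => EuclideanSpace.single i (1 : ℝ) using 4 with i j
  rw [h]
  simp [sub_smul, Finset.sum_sub_distrib]

lemma exists_measure_integral_exp
    (hT : ∫⁻ s in {s : ℝ | 1 < |s|}, ENNReal.ofReal |s| ∂T.ν < ∞) (J : Finset (TestSpace d)) :
    ∃ μ : Measure (J → ℝ), IsProbabilityMeasure μ ∧ ∀ z : J → ℝ,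
      ∫ x, Complex.exp (Complex.I * (∑ i, z i * x i : ℝ)) ∂μ =
        T.levyFunctional (∑ i, z i • (i : TestSpace d)) := by
  obtain ⟨μ, hμ, h⟩ := T.exists_charFun_eq_levyFunctional hT fun i : J => (i : TestSpace d)
  refine ⟨μ.map WithLp.ofLp,
    Measure.isProbabilityMeasure_map (WithLp.measurable_ofLp 2 _).aemeasurable, fun z => ?_⟩
  rw [integral_map (WithLp.measurable_ofLp 2 _).aemeasurable
    (by fun_prop : Continuous fun x : J → ℝ =>
      Complex.exp (Complex.I * (∑ i, z i * x i : ℝ))).aestronglyMeasurable]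
  have := congrFun h (WithLp.toLp 2 z)
  rw [charFun_apply] at this
  rw [← this]
  congr 1 with x
  rw [PiLp.inner_apply, mul_comm]
  simp

/-- A measure on `ℝ^{𝓢}` under which the coordinate process has the Fourier transform of the Lévy
noise. -/
lemma exists_measure_integral_exp_linearCombination
    (hT : ∫⁻ s in {s : ℝ | 1 < |s|}, ENNReal.ofReal |s| ∂T.ν < ∞) :
    ∃ μ : Measure (TestSpace d → ℝ), IsProbabilityMeasure μ ∧ ∀ l : TestSpace d →₀ ℝ,
      ∫ ω, Complex.exp (Complex.I * (Finsupp.linearCombination ℝ ω l : ℝ)) ∂μ =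
        T.levyFunctional (Finsupp.linearCombination ℝ id l) := by
  choose P hP hPint using T.exists_measure_integral_exp (d := d) hT
  obtain ⟨μ, hμ⟩ := exists_isProjectiveLimit (isProjectiveMeasureFamily_of_integral_exp hPint)
  exact ⟨μ, hμ.isProbabilityMeasure, integral_exp_linearCombination_of_isProjectiveLimit hPint hμ⟩

/-- A linear field with Fourier transform `exp (∫ ψ(f(x)) dx)` is continuous in probability with
respect to the mixed norm. -/
theorem tripleStochContinuous_of_fourier
    (hT : ∫⁻ s in {s : ℝ | 1 < |s|}, ENNReal.ofReal |s| ∂T.ν < ∞)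
    {Ω : Type*} [MeasurableSpace Ω] {P : Measure Ω} [IsProbabilityMeasure P]
    {Z : TestSpace d → Ω → ℝ} (hm : ∀ f, Measurable (Z f))
    (hlin : ∀ (α β : ℝ) (f g : TestSpace d),
      ∀ᵐ ω ∂P, Z (α • f + β • g) ω = α * Z f ω + β * Z g ω)
    (hF : ∀ f, fieldFourierTransform P Z f = T.levyFunctional f) :
    TripleStochContinuous P Z := by
  intro f₀
  rw [tendstoInMeasure_iff_measureReal_norm]
  intro ε hε
  -- The tail bound at level r = ε/2 integrates 1 - charFun over [-2/r, 2/r] = [-R, R]. Halving ε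
  -- turns the event ≥ ε into the strict event > ε/2.
  let R : ℝ := 4 / ε
  have hR : 0 < R := by positivity
  -- η(g) bounds |∫ ψ(t g)| uniformly for |t| ≤ R. When η(g) ≤ 1, |exp w - 1| ≤ 2|w| applies to this
  -- integral.
  let η : TestSpace d → ℝ := fun g =>
    T.psiBound * ((R * tripleNorm g) ^ 2 + R * tripleNorm g)
  have hη : Tendsto (fun f => η (f - f₀)) (tripleNhds f₀) (𝓝 0) := by
    have h := (tendsto_tripleNorm_sub f₀).const_mul R
    simpa [η] using ((h.pow 2).add h).const_mul T.psiBound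
  have hchar (g : TestSpace d) (t : ℝ) : charFun (P.map (Z g)) t = T.levyFunctional (t • g) := by
    rw [← hF, charFun_apply_real, integral_map (hm g).aemeasurable
      (by fun_prop : Continuous fun x : ℝ =>
        Complex.exp (t * x * Complex.I)).aestronglyMeasurable]
    refine integral_congr_ae ?_
    filter_upwards [hlin t 0 g 0] with ω h
    have h' : Z (t • g) ω = t * Z g ω := by simpa using h
    rw [h', mul_comm Complex.I]
    push_cast
    rfl
  have htail (g : TestSpace d) (hg : η g ≤ 1) :
      (P.map (Z g)).real {x | ε / 2 < |x|} ≤ 4 * η g := by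
    have := Measure.isProbabilityMeasure_map (μ := P) (hm g).aemeasurable
    refine (measureReal_abs_gt_le_integral_charFun (μ := P.map (Z g)) (half_pos hε)).trans ?_
    have hRε : 2 * (ε / 2)⁻¹ = R := by simp only [R]; field_simp; norm_num
    have hbd : ∀ t ∈ Set.uIoc (-2 * (ε / 2)⁻¹) (2 * (ε / 2)⁻¹),
        ‖1 - charFun (P.map (Z g)) t‖ ≤ 2 * η g := by
      intro t ht
      rw [neg_mul, hRε, Set.uIoc_of_le (by linarith)] at ht
      have htR : |t| ≤ R := abs_le.2 ⟨ht.1.le, ht.2⟩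
      have hw : ‖∫ x, T.psi ((t • g) x)‖ ≤ η g := by
        refine (T.norm_integral_psi_le hT (t • g)).trans ?_
        have := tripleNorm_nonneg g
        rw [tripleNorm_smul]
        simp only [η]
        gcongr
        exact T.psiBound_nonneg
      rw [hchar, norm_sub_rev, levyFunctional]
      exact (Complex.norm_exp_sub_one_le (hw.trans hg)).trans (by gcongr)
    have hint := intervalIntegral.norm_integral_le_of_norm_le_const hbd
    rw [neg_mul, hRε, sub_neg_eq_add, abs_of_pos (by linarith)] at hint
    rw [neg_mul, hRε]
    calc 2⁻¹ * (ε / 2) * ‖∫ t in -R..R, 1 - charFun (P.map (Z g)) t‖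
        ≤ 2⁻¹ * (ε / 2) * (2 * η g * (R + R)) := by gcongr
      _ = 4 * η g := by simp only [R]; field_simp; ring
  refine squeeze_zero' (Eventually.of_forall fun f => measureReal_nonneg)
    (g := fun f => 4 * η (f - f₀)) ?_ (by simpa using hη.const_mul 4)
  filter_upwards [hη.eventually_le_const one_pos] with f hf
  refine le_trans ?_ (htail (f - f₀) hf)
  rw [map_measureReal_apply (hm _) (measurableSet_lt measurable_const (by fun_prop))]
  refine ENNReal.toReal_mono (measure_ne_top _ _) (measure_mono_ae ?_)
  filter_upwards [ae_map_sub hlin f f₀] with ω h hω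
  have h1 : ε ≤ |Z f ω - Z f₀ ω| := hω
  have h2 : ε / 2 < |Z (f - f₀) ω| := by rw [h]; linarith
  exact h2

theorem exists_isLevyNoiseField
    (hT : ∫⁻ s in {s : ℝ | 1 < |s|}, ENNReal.ofReal |s| ∂T.ν < ∞) :
    ∃ P : Measure (TestSpace d → ℝ), IsLevyNoiseField T P fun f ω => ω f := by
  obtain ⟨P, hP, hint⟩ := T.exists_measure_integral_exp_linearCombination (d := d) hT
  have hm (f : TestSpace d) : Measurable fun ω : TestSpace d → ℝ => ω f := measurable_pi_apply f
  have hF (f : TestSpace d) :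
      fieldFourierTransform P (fun f ω => ω f) f = T.levyFunctional f := by
    simpa [fieldFourierTransform] using hint (Finsupp.single f 1)
  have hlin (α β : ℝ) (f g : TestSpace d) :
      ∀ᵐ ω ∂P, ω (α • f + β • g) = α * ω f + β * ω g := by
    have hX : Measurable fun ω : TestSpace d → ℝ =>
        ω (α • f + β • g) - (α * ω f + β * ω g) :=
      (hm _).sub (((hm f).const_mul α).add ((hm g).const_mul β))
    have := Measure.isProbabilityMeasure_map (μ := P) hX.aemeasurable
    -- At every t, the characteristic function of the linearity defect is φ evaluated at a formal
    -- combination whose value in 𝓢 is 0. It is therefore identically 1, and the defect vanishes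
    -- almost surely.
    have hdirac : P.map (fun ω => ω (α • f + β • g) - (α * ω f + β * ω g)) =
        Measure.dirac (0 : ℝ) := by
      refine Measure.ext_of_charFun ?_
      ext t
      rw [charFun_dirac, charFun_apply_real, integral_map hX.aemeasurable
        (by fun_prop : Continuous fun x : ℝ =>
          Complex.exp (t * x * Complex.I)).aestronglyMeasurable]
      have h := hint (Finsupp.single (α • f + β • g) t -
        (Finsupp.single f (t * α) + Finsupp.single g (t * β)))
      have h0 : Finsupp.linearCombination ℝ id (Finsupp.single (α • f + β • g) t -
          (Finsupp.single f (t * α) + Finsupp.single g (t * β))) = (0 : TestSpace d) := by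
        simp only [map_sub, map_add, Finsupp.linearCombination_single, id, smul_add, mul_smul,
          sub_self]
      rw [h0, levyFunctional_zero] at h
      simp only [inner_zero_left, Complex.ofReal_zero, zero_mul, Complex.exp_zero]
      rw [← h]
      congr 1 with ω
      simp only [map_sub, map_add, Finsupp.linearCombination_single, smul_eq_mul]
      congr 1
      push_cast
      ring
    have h1 : ∀ᵐ x ∂(P.map fun ω => ω (α • f + β • g) - (α * ω f + β * ω g)), x = 0 := by
      rw [hdirac, ae_dirac_eq]
      rfl
    filter_upwards [ae_of_ae_map hX.aemeasurable h1] with ω h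
    exact sub_eq_zero.1 h
  exact ⟨P, ⟨⟨hP, hm, hlin, (T.tripleStochContinuous_of_fourier hT hm hlin hF).tendstoInMeasure⟩,
    T.integrable_psi_schwartz hT, hF⟩⟩

end CharacteristicTriplet

end Field

theorem proposition3p3 (d : ℕ) (T : CharacteristicTriplet)
    (hT : ∫⁻ s in {s : ℝ | 1 < |s|}, ENNReal.ofReal |s| ∂T.ν < ∞) :
    -- the functional is correctly defined
    (∀ t : ℝ, Integrable (CharacteristicTriplet.jumpIntegrand t) T.ν) ∧
    (∀ f : TestSpace d, Integrable (fun x => T.psi (f x))) ∧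
    -- it is a characteristic functional, continuous with respect to the mixed norm
    IsCharacteristicFunctional (fun f : TestSpace d => T.levyFunctional f) ∧
    TripleContinuous (fun f : TestSpace d => T.levyFunctional f) ∧
    -- existence of the associated noise field
    (∃ (Ω : Type) (_ : MeasurableSpace Ω) (P : Measure Ω) (Z : TestSpace d → Ω → ℝ),
      IsLevyNoiseField T P Z) ∧
    -- uniqueness up to equivalence in law
    (∀ (Ω₁ : Type*) (Ω₂ : Type*) [MeasurableSpace Ω₁] [MeasurableSpace Ω₂]
      (P₁ : Measure Ω₁) (P₂ : Measure Ω₂)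
      (Z₁ : TestSpace d → Ω₁ → ℝ) (Z₂ : TestSpace d → Ω₂ → ℝ),
      IsLevyNoiseField T P₁ Z₁ → IsLevyNoiseField T P₂ Z₂ → EquivalentInLaw P₁ Z₁ P₂ Z₂) ∧
    -- every such field is continuous with respect to the mixed norm
    (∀ (Ω : Type*) [MeasurableSpace Ω] (P : Measure Ω) (Z : TestSpace d → Ω → ℝ),
      IsLevyNoiseField T P Z → TripleStochContinuous P Z) := by
  exact ⟨T.integrable_jumpIntegrand hT, T.integrable_psi_schwartz hT,
    ⟨T.levyFunctional_zero, (T.tripleContinuous_levyFunctional hT).continuous,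
      fun _ f => T.posSemidef_levyFunctional hT f⟩,
    T.tripleContinuous_levyFunctional hT,
    let ⟨P, hP⟩ := T.exists_isLevyNoiseField hT
    ⟨_, _, P, _, hP⟩,
    fun _ _ _ _ _ _ _ _ h₁ h₂ =>
      have := h₁.isGeneralizedRandomField.isProbabilityMeasure
      have := h₂.isGeneralizedRandomField.isProbabilityMeasure
      equivalentInLaw_of_fieldFourierTransform_eq h₁.isGeneralizedRandomField.measurable
        h₂.isGeneralizedRandomField.measurable h₁.isGeneralizedRandomField.linear
        h₂.isGeneralizedRandomField.linear
        (funext fun f => (h₁.fourier_eq f).trans (h₂.fourier_eq f).symm),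
    fun _ _ _ _ h =>
      have := h.isGeneralizedRandomField.isProbabilityMeasure
      T.tripleStochContinuous_of_fourier hT h.isGeneralizedRandomField.measurable
        h.isGeneralizedRandomField.linear h.fourier_eq⟩
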